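/- Let $\mathbb{N}=\{1,2,\dots\}$, and work in a nonstandard extension ${}^{\ast}$ of the standard universe that satisfies the transfer principle and is $|\wp(\mathbb{N})|^{+}$-saturated (every family of at most $|\wp(\mathbb{N})|$ internal sets with the finite intersection property has nonempty intersection). Let $\mathbb{P}$ be the set of polynomials with integer coefficients that vanish at $0$ and map $\mathbb{N}$ into $\mathbb{N}$. An IP-set is a family $(x_\alpha)_{\alpha\in\wp_{fin}(\mathbb{N})\setminus\{\emptyset\}}$ of the form $x_\alpha=\sum_{n\in\alpha}y_n$ for a sequence $(y_n)$ in $\mathbb{N}$; let $\mathcal{IP}$ be the set of all IP-sets. A set $A$ of natural numbers is a $J_p$-set if for every finite $F\subset\mathbb{P}$, every $l\in\mathbb{N}$ and all IP-sets $(x^i_\alpha)_\alpha$, $i=1,\dots,l$, there are $a\in\mathbb{N}\cup\{0\}$ and $\beta\in\wp_{fin}(\mathbb{N})\setminus\{\emptyset\}$ with $a+P(x^i_\beta)\in A$ for all $P\in F$ and all $i\in\{1,\dots,l\}$. Then for every set $A$ of natural numbers the following are equivalent: 1. $A$ is a $J_p$-set; 2. there are $\eta\in{}^{\ast}(\mathbb{N}\cup\{0\})$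 and $\beta\in{}^{\ast}(\wp_{fin}(\mathbb{N})\setminus\{\emptyset\})$ such that for all IP-sets $x=(x_\alpha)_\alpha$ and all $P\in\mathbb{P}$, $\eta+{}^{\ast}P(x_\beta)\in{}^{\ast}A$, where $x_\beta=({}^{\ast}x)_\beta$; 3. there are $\eta\in{}^{\ast}(\mathbb{N}\cup\{0\})$, $\beta\in{}^{\ast}(\wp_{fin}(\mathbb{N})\setminus\{\emptyset\})$, $I\in{}^{\ast}\wp_{fin}(\mathcal{IP})$ and $H\in{}^{\ast}\wp_{fin}(\mathbb{P})$ such that ${}^{\ast}x\in I$ for every $x\in\mathcal{IP}$, ${}^{\ast}P\in H$ for every $P\in\mathbb{P}$, and $\eta+P(x_\beta)\in{}^{\ast}A$ for all (internal) $x\in I$ and all $P\in H$. -/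

import Mathlib

open Polynomial

universe u

/-! ### Nonstandard extensions of the universe of standard objects

The standard universe is the family of all types in `Type`.  Its full language has one sort for
each type and a symbol for every standard element, every standard function, every standard set
and pairing (so also for every function and relation of several variables).  -/

/-- An interpretation of the full many-sorted language of the standard universe. -/
structure FullStructure where
  /-- the carrier `*T` of the sort `T` -/
  Star : Type → Type u
  /-- the element `*t` of `*T` -/
  const : {T : Type} → T → Star T
  /-- the function `*f : *S → *T` -/
  fn : {S T : Type} → (S → T) → Star S → Star T
  /-- the pair `(s, t)` as an element of `*(S × T)` -/
  pair : {S T : Type} → Star S → Star T → Star (S × T)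
  /-- the set `*A ⊆ *T` -/
  set : {T : Type} → Set T → Set (Star T)

/-- The standard universe itself. -/
def FullStructure.standard : FullStructure.{0} where
  Star := fun T => T
  const := fun t => t
  fn := fun f => f
  pair := fun s t => (s, t)
  set := fun A => A

namespace FullLanguage

/-- Variables of sort `T` in the context `Γ` (the list of the sorts of the free variables). -/
inductive Var : List Type → Type → Type 1
  | zero {Γ : List Type} {T : Type} : Var (T :: Γ) T
  | succ {Γ : List Type} {S T : Type} : Var Γ T → Var (S :: Γ) T

/-- Terms of sort `T` in the context `Γ`. -/
inductive Term (Γ : List Type) : Type → Type 1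
  | var {T : Type} : Var Γ T → Term Γ T
  | const {T : Type} : T → Term Γ T
  | app {S T : Type} : (S → T) → Term Γ S → Term Γ T
  | pair {S T : Type} : Term Γ S → Term Γ T → Term Γ (S × T)

/-- First-order formulas in the context `Γ`; quantifiers range over a sort. -/
inductive Formula : List Type → Type 1
  | mem {Γ : List Type} {T : Type} : Term Γ T → Set T → Formula Γ
  | equal {Γ : List Type} {T : Type} : Term Γ T → Term Γ T → Formula Γ
  | not {Γ : List Type} : Formula Γ → Formula Γ
  | and {Γ : List Type} : Formula Γ → Formula Γ → Formula Γ
  | ex {Γ : List Type} (T : Type) : Formula (T :: Γ) → Formula Γ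

/-- Assignments of values in `M` to the variables of a context. -/
def Env (M : FullStructure.{u}) : List Type → Type u
  | [] => PUnit
  | T :: Γ => M.Star T × Env M Γ

/-- The value of a variable under an assignment. -/
def Var.value (M : FullStructure.{u}) :
    {Γ : List Type} → {T : Type} → Var Γ T → Env M Γ → M.Star T
  | _, _, .zero, e => e.1
  | _, _, .succ v, e => v.value M e.2
termination_by structural _ _ v => v

/-- The value of a term under an assignment. -/
def Term.value (M : FullStructure.{u}) {Γ : List Type} (e : Env M Γ) :
    {T : Type} → Term Γ T → M.Star T
  | _, .var v => v.value M e
  | _, .const t => M.const t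
  | _, .app f s => M.fn f (s.value M e)
  | _, .pair s t => M.pair (s.value M e) (t.value M e)
termination_by structural _ t => t

/-- Satisfaction of a formula under an assignment. -/
def Formula.Holds (M : FullStructure.{u}) : {Γ : List Type} → Formula Γ → Env M Γ → Prop
  | _, .mem t A, e => t.value M e ∈ M.set A
  | _, .equal s t, e => s.value M e = t.value M e
  | _, .not φ, e => ¬ φ.Holds M e
  | _, .and φ ψ, e => φ.Holds M e ∧ ψ.Holds M e
  | _, .ex T φ, e => ∃ t : M.Star T, φ.Holds M (t, e)

end FullLanguage

namespace FullStructure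

/-- The transfer principle: a sentence (with standard parameters) holds of the standard universe
if and only if its star-transform holds. -/
def Transfer (M : FullStructure.{u}) : Prop :=
  ∀ φ : FullLanguage.Formula [], φ.Holds standard PUnit.unit ↔ φ.Holds M PUnit.unit

/-- The function `*f : *S × *T → *R` of two variables. -/
def fn₂ (M : FullStructure.{u}) {S T R : Type} (f : S → T → R) (s : M.Star S) (t : M.Star T) :
    M.Star R :=
  M.fn (fun p : S × T => f p.1 p.2) (M.pair s t)

/-- The relation `*∈` between `*T` and `*℘(T)`. -/
def Mem (M : FullStructure.{u}) {T : Type} (t : M.Star T) (B : M.Star (Set T)) : Prop :=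
  M.pair t B ∈ M.set {p : T × Set T | p.1 ∈ p.2}

/-- The relation `*∈` between `*T` and `*℘_fin(T)`, the hyperfinite internal subsets of `*T`. -/
def MemFin (M : FullStructure.{u}) {T : Type} (t : M.Star T) (B : M.Star (Finset T)) : Prop :=
  M.pair t B ∈ M.set {p : T × Finset T | p.1 ∈ p.2}

/-- The internal subsets of `*T` are those given by the elements of `*℘(T)`. -/
def IsInternal (M : FullStructure.{u}) {T : Type} (D : Set (M.Star T)) : Prop :=
  ∃ B : M.Star (Set T), D = {t | M.Mem t B}

/-- `κ`-saturation: every family of fewer than `κ` internal sets with the finite intersection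
property has nonempty intersection. -/
def Saturated (M : FullStructure.{u}) (κ : Cardinal.{0}) : Prop :=
  ∀ (T ι : Type) (D : ι → Set (M.Star T)), Cardinal.mk ι < κ → (∀ i, M.IsInternal (D i)) →
    (∀ s : Finset ι, (⋂ i ∈ s, D i).Nonempty) → (⋂ i, D i).Nonempty

end FullStructure

/-! ### IP-sets, polynomials and `J_p`-sets

Here `ℕ` contains `0`; positivity is written out where it is meant. -/

/-- `℘_fin(ℕ) ∖ {∅}`. -/
abbrev PFin : Type := {α : Finset ℕ // α.Nonempty}

/-- IP-sets `(x_α)_α` of positive integers: `x_α = ∑_{n ∈ α} y_n` for a sequence `(y_n)` of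
positive integers. -/
abbrev IPSet : Type :=
  {x : PFin → ℕ // ∃ y : ℕ → ℕ, (∀ n, 0 < y n) ∧ ∀ α : PFin, x α = ∑ n ∈ α.1, y n}

/-- The polynomials with integer coefficients that vanish at `0` and map positive integers to
positive integers. -/
abbrev PolyP : Type :=
  {P : ℤ[X] // P.eval 0 = 0 ∧ ∀ n : ℕ, 0 < n → 0 < P.eval (n : ℤ)}

/-- The map `ℕ → ℕ` induced by `P`; see `PolyP.natCast_toFun`. -/
noncomputable def PolyP.toFun (P : PolyP) (n : ℕ) : ℕ := (P.1.eval (n : ℤ)).toNat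

theorem PolyP.natCast_toFun (P : PolyP) (n : ℕ) : (P.toFun n : ℤ) = P.1.eval (n : ℤ) := by
  refine Int.toNat_of_nonneg ?_
  rcases Nat.eq_zero_or_pos n with rfl | hn
  · simp [P.2.1]
  · exact (P.2.2 n hn).le

/-- `A` is a `J_p`-set. -/
def IsJpSet (A : Set ℕ) : Prop :=
  ∀ (F : Finset PolyP) (l : ℕ) (x : Fin l → IPSet), ∃ (a : ℕ) (β : PFin),
    ∀ P ∈ F, ∀ i, a + P.toFun ((x i).1 β) ∈ A

/-!
Several elements of nonstandard sorts can be coded as one element `u` of a product sort, so that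
each quantity is the value at `u` of a star-extended standard function. Transfer therefore enters
only through the rules by which `*` respects inclusions, binary intersections, composition, pairing
and preimages (`FullStructure.Transfer.mem_mono` to `FullStructure.Transfer.mem_fn_iff`).

From `J_p` to hyperfinite families: call a quadruple `(a, β, I, H)` good if `a + P(x_β) ∈ A` for
all `x ∈ I` and `P ∈ H`. For an IP-set `x` consider the good quadruples with `x ∈ I`, and for a
polynomial `P` those with `P ∈ H`. There are at most `2 ^ ℵ₀` such sets, the `J_p`-property says
that any finitely many of them meet (`IsJpSet.exists_good`), and so by saturation their
star-extensions have a common element, whose components are the required objects. Specializing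
`I` and `H` to standard members gives the second statement. Conversely, for finitely many
polynomials and IP-sets the second statement puts the pair `(η, β)` into the star-extension of a
finite intersection of standard sets, which is then itself nonempty.
-/

namespace FullStructure

variable {M : FullStructure.{u}}

/-! ### Consequences of transfer -/

open FullLanguage in
theorem Transfer.forall_holds (hM : M.Transfer) {T : Type} (φ : Formula [T])
    (h : ∀ t : T, φ.Holds standard (t, PUnit.unit)) (t : M.Star T) :
    φ.Holds M (t, PUnit.unit) := by
  have key := (hM (.not (.ex T (.not φ)))).1 fun ⟨s, hs⟩ => hs (h s)
  by_contra hn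
  exact key ⟨t, hn⟩

open FullLanguage in
theorem Transfer.mem_mono (hM : M.Transfer) {T : Type} {A B : Set T} (hAB : A ⊆ B)
    {t : M.Star T} (ht : t ∈ M.set A) : t ∈ M.set B := by
  have key := hM.forall_holds (.not (.and (.mem (.var .zero) A) (.not (.mem (.var .zero) B))))
    (fun s hs => hs.2 (hAB hs.1)) t
  by_contra hn
  exact key ⟨ht, hn⟩

open FullLanguage in
theorem Transfer.mem_inter (hM : M.Transfer) {T : Type} {A B : Set T} {t : M.Star T}
    (hA : t ∈ M.set A) (hB : t ∈ M.set B) : t ∈ M.set (A ∩ B) := by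
  have key := hM.forall_holds
    (.not (.and (.and (.mem (.var .zero) A) (.mem (.var .zero) B))
      (.not (.mem (.var .zero) (A ∩ B)))))
    (fun s hs => hs.2 hs.1) t
  by_contra hn
  exact key ⟨⟨hA, hB⟩, hn⟩

open FullLanguage in
theorem Transfer.mem_univ (hM : M.Transfer) {T : Type} (t : M.Star T) : t ∈ M.set Set.univ :=
  hM.forall_holds (.mem (.var .zero) (Set.univ : Set T)) (fun s => Set.mem_univ s) t

open FullLanguage in
theorem Transfer.nonempty_of_mem (hM : M.Transfer) {T : Type} {A : Set T} {t : M.Star T}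
    (ht : t ∈ M.set A) : A.Nonempty :=
  (hM (.ex T (.mem (.var .zero) A))).2 ⟨t, ht⟩

open FullLanguage in
theorem Transfer.const_mem (hM : M.Transfer) {T : Type} {A : Set T} {t : T} (ht : t ∈ A) :
    M.const t ∈ M.set A :=
  (hM (.mem (.const t) A)).1 ht

open FullLanguage in
theorem Transfer.fn_comp (hM : M.Transfer) {S T R : Type} (g : T → R) (f : S → T)
    (s : M.Star S) : M.fn g (M.fn f s) = M.fn (fun s => g (f s)) s :=
  hM.forall_holds (.equal (.app g (.app f (.var .zero))) (.app (fun s => g (f s)) (.var .zero)))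
    (fun _ => rfl) s

open FullLanguage in
theorem Transfer.pair_fn (hM : M.Transfer) {S T R : Type} (f : S → T) (g : S → R)
    (s : M.Star S) : M.pair (M.fn f s) (M.fn g s) = M.fn (fun s => (f s, g s)) s :=
  hM.forall_holds (.equal (.pair (.app f (.var .zero)) (.app g (.var .zero)))
    (.app (fun s => (f s, g s)) (.var .zero))) (fun _ => rfl) s

open FullLanguage in
theorem Transfer.const_eq_fn (hM : M.Transfer) {S T : Type} (t : T) (s : M.Star S) :
    M.const t = M.fn (fun _ => t) s :=
  hM.forall_holds (.equal (.const t) (.app (fun _ : S => t) (.var .zero))) (fun _ => Eq.refl t) s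

open FullLanguage in
theorem Transfer.fn_id (hM : M.Transfer) {T : Type} (t : M.Star T) : M.fn (fun t => t) t = t :=
  hM.forall_holds (.equal (.app (fun t : T => t) (.var .zero)) (.var .zero)) (fun s => Eq.refl s) t

open FullLanguage in
theorem Transfer.fn_fst_pair (hM : M.Transfer) {S T : Type} (s : M.Star S) (t : M.Star T) :
    M.fn Prod.fst (M.pair s t) = s := by
  have key := (hM (.not (.ex T (.ex S (.not (.equal
    (.app Prod.fst (.pair (.var .zero) (.var (.succ .zero)))) (.var .zero))))))).1
    fun ⟨_, _, h⟩ => h rfl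
  by_contra hn
  exact key ⟨t, s, hn⟩

open FullLanguage in
theorem Transfer.fn_snd_pair (hM : M.Transfer) {S T : Type} (s : M.Star S) (t : M.Star T) :
    M.fn Prod.snd (M.pair s t) = t := by
  have key := (hM (.not (.ex T (.ex S (.not (.equal
    (.app Prod.snd (.pair (.var .zero) (.var (.succ .zero)))) (.var (.succ .zero)))))))).1
    fun ⟨_, _, h⟩ => h rfl
  by_contra hn
  exact key ⟨t, s, hn⟩

open FullLanguage in
theorem Transfer.mem_fn_iff (hM : M.Transfer) {S T : Type} (f : S → T) (A : Set T)
    (s : M.Star S) : M.fn f s ∈ M.set A ↔ s ∈ M.set (f ⁻¹' A) := by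
  have h₁ := hM.forall_holds (.not (.and (.mem (.app f (.var .zero)) A)
    (.not (.mem (.var .zero) (f ⁻¹' A))))) (fun s hs => hs.2 hs.1) s
  have h₂ := hM.forall_holds (.not (.and (.mem (.var .zero) (f ⁻¹' A))
    (.not (.mem (.app f (.var .zero)) A)))) (fun s hs => hs.2 hs.1) s
  constructor
  · intro h
    by_contra hn
    exact h₁ ⟨h, hn⟩
  · intro h
    by_contra hn
    exact h₂ ⟨h, hn⟩

theorem Transfer.fn₂_fn (hM : M.Transfer) {U S T R : Type} (f : S → T → R) (g : U → S)
    (h : U → T) (v : M.Star U) :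
    M.fn₂ f (M.fn g v) (M.fn h v) = M.fn (fun v => f (g v) (h v)) v := by
  rw [fn₂, hM.pair_fn, hM.fn_comp]

theorem Transfer.memFin_fn_iff (hM : M.Transfer) {U T : Type} (g : U → T) (h : U → Finset T)
    (v : M.Star U) : M.MemFin (M.fn g v) (M.fn h v) ↔ v ∈ M.set {v | g v ∈ h v} := by
  rw [MemFin, hM.pair_fn, hM.mem_fn_iff]
  rfl

theorem Transfer.fn₂_const (hM : M.Transfer) {S T R : Type} (f : S → T → R) (s : S)
    (t : M.Star T) : M.fn₂ f (M.const s) t = M.fn (f s) t := by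
  conv_lhs => rw [hM.const_eq_fn s t, ← hM.fn_id t, hM.fn_comp]
  exact hM.fn₂_fn f (fun _ => s) (fun t => t) t

theorem Transfer.mem_biInter (hM : M.Transfer) {T ι : Type} (s : Finset ι) (A : ι → Set T)
    {t : M.Star T} (ht : ∀ i ∈ s, t ∈ M.set (A i)) : t ∈ M.set (⋂ i ∈ s, A i) := by
  classical
  induction s using Finset.induction_on with
  | empty => simpa using hM.mem_univ t
  | insert i s _ ih =>
    rw [Finset.set_biInter_insert]
    exact hM.mem_inter (ht i (Finset.mem_insert_self i s))
      (ih fun j hj => ht j (Finset.mem_insert_of_mem hj))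

theorem Transfer.isInternal_set (hM : M.Transfer) {T : Type} (A : Set T) :
    M.IsInternal (M.set A) := by
  refine ⟨M.const A, Set.ext fun t => ?_⟩
  have h : M.pair t (M.const A) = M.fn (fun s => (s, A)) t := by
    conv_lhs => rw [hM.const_eq_fn A t]; arg 2; rw [← hM.fn_id t]
    exact hM.pair_fn _ _ t
  rw [Set.mem_ofPred_eq, Mem, h, hM.mem_fn_iff]
  rfl

/-- Saturation for the star-extensions of standard sets: if any finitely many of at most `κ`
standard sets have a common element, then their star-extensions have one. -/
theorem Saturated.exists_mem_set (hM : M.Transfer) {κ : Cardinal.{0}}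
    (hsat : M.Saturated (Order.succ κ)) {T ι : Type} (hι : Cardinal.mk ι ≤ κ) (A : ι → Set T)
    (h : ∀ s : Finset ι, (⋂ i ∈ s, A i).Nonempty) : ∃ t : M.Star T, ∀ i, t ∈ M.set (A i) := by
  obtain ⟨t, ht⟩ := hsat T ι (fun i => M.set (A i)) (Order.lt_succ_iff.2 hι)
    (fun i => hM.isInternal_set (A i)) fun s => by
      obtain ⟨t, ht⟩ := h s
      exact ⟨M.const t, Set.mem_iInter₂.2 fun i hi => hM.const_mem (Set.mem_iInter₂.1 ht i hi)⟩
  exact ⟨t, Set.mem_iInter.1 ht⟩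

end FullStructure

/-! ### IP-sets, polynomials and `J_p`-sets -/

theorem mk_ipSet_sum_polyP_le : Cardinal.mk (IPSet ⊕ PolyP) ≤ Cardinal.mk (Set ℕ) := by
  have hP : Cardinal.mk PolyP ≤ Cardinal.continuum := by
    have : Countable ℤ[X] :=
      Cardinal.mk_le_aleph0_iff.1 (Polynomial.cardinalMk_le_max.trans (by simp))
    exact (Cardinal.mk_le_aleph0 (α := PolyP)).trans Cardinal.aleph0_le_continuum
  have hX : Cardinal.mk IPSet ≤ Cardinal.continuum := by
    refine (Cardinal.mk_subtype_le _).trans ?_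
    have : Infinite PFin :=
      Infinite.of_injective (fun n : ℕ => (⟨{n}, Finset.singleton_nonempty n⟩ : PFin))
        fun m n h => Finset.singleton_injective (congrArg Subtype.val h)
    rw [← Cardinal.power_def, Cardinal.mk_nat, Cardinal.mk_eq_aleph0 PFin,
      Cardinal.aleph0_power_aleph0]
  rw [Cardinal.mk_sum, Cardinal.lift_id, Cardinal.lift_id, Cardinal.mk_set, Cardinal.mk_nat,
    Cardinal.two_power_aleph0]
  exact (add_le_add hX hP).trans Cardinal.continuum_add_self.le

/-- Quadruples `(a, β, I, H)` with `a + P(x_β) ∈ A` for all `x ∈ I` and all `P ∈ H`. -/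
def goodQuadruples (A : Set ℕ) : Set (ℕ × PFin × Finset IPSet × Finset PolyP) :=
  {t | ∀ x ∈ t.2.2.1, ∀ P ∈ t.2.2.2, t.1 + P.toFun (x.1 t.2.1) ∈ A}

/-- The `J_p`-property with the finitely many IP-sets given as a finite set. -/
theorem IsJpSet.exists_good {A : Set ℕ} (hA : IsJpSet A) (I : Finset IPSet)
    (H : Finset PolyP) : ∃ (a : ℕ) (β : PFin), (a, β, I, H) ∈ goodQuadruples A := by
  obtain ⟨a, β, h⟩ := hA H I.card fun i => (I.equivFin.symm i).1
  refine ⟨a, β, fun x hx P hP => ?_⟩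
  simpa using h P hP (I.equivFin ⟨x, hx⟩)

section Characterizations

variable {M : FullStructure.{u}} {A : Set ℕ}

theorem IsJpSet.of_exists_star (hM : M.Transfer) {η : M.Star ℕ} {β : M.Star PFin}
    (h : ∀ (x : IPSet) (P : PolyP),
      M.fn₂ (fun a b : ℕ => a + b) η (M.fn P.toFun (M.fn x.1 β)) ∈ M.set A) : IsJpSet A := by
  intro F l x
  obtain ⟨⟨a, γ⟩, ht⟩ := hM.nonempty_of_mem <| hM.mem_biInter (F ×ˢ Finset.univ)
    (fun q : PolyP × Fin l => {t : ℕ × PFin | t.1 + q.1.toFun ((x q.2).1 t.2) ∈ A})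
    (t := M.pair η β) fun q _ => by
      have hq := h (x q.2) q.1
      rw [← hM.fn_fst_pair η β, hM.fn_comp] at hq
      nth_rewrite 2 [← hM.fn_snd_pair η β] at hq
      rw [hM.fn_comp, hM.fn₂_fn, hM.mem_fn_iff] at hq
      exact hq
  refine ⟨a, γ, fun P hP i => ?_⟩
  exact Set.mem_iInter₂.1 ht (P, i) (Finset.mem_product.2 ⟨hP, Finset.mem_univ i⟩)

/-- The components of a nonstandard good quadruple satisfy the starred defining property, for
all internal members of its hyperfinite sets. -/
theorem mem_star_of_mem_goodQuadruples (hM : M.Transfer)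
    {t : M.Star (ℕ × PFin × Finset IPSet × Finset PolyP)} (ht : t ∈ M.set (goodQuadruples A))
    {x : M.Star IPSet} (hx : M.MemFin x (M.fn (fun t => t.2.2.1) t))
    {P : M.Star PolyP} (hP : M.MemFin P (M.fn (fun t => t.2.2.2) t)) :
    M.fn₂ (fun a b : ℕ => a + b) (M.fn (fun t => t.1) t)
      (M.fn₂ PolyP.toFun P (M.fn₂ (fun (z : IPSet) (γ : PFin) => z.1 γ) x
        (M.fn (fun t => t.2.1) t))) ∈ M.set A := by
  -- Every quantity involved becomes a function of the single element `(t, (x, P))`.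
  obtain ⟨v, rfl, rfl, rfl⟩ : ∃ v : M.Star
      ((ℕ × PFin × Finset IPSet × Finset PolyP) × IPSet × PolyP),
      M.fn (fun v => v.1) v = t ∧ M.fn (fun v => v.2.1) v = x ∧ M.fn (fun v => v.2.2) v = P := by
    refine ⟨M.pair t (M.pair x P), hM.fn_fst_pair _ _, ?_, ?_⟩
    · rw [← hM.fn_comp Prod.fst Prod.snd, hM.fn_snd_pair, hM.fn_fst_pair]
    · rw [← hM.fn_comp Prod.snd Prod.snd, hM.fn_snd_pair, hM.fn_snd_pair]
  rw [hM.fn_comp, hM.memFin_fn_iff] at hx hP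
  rw [hM.mem_fn_iff] at ht
  rw [hM.fn_comp, hM.fn_comp, hM.fn₂_fn, hM.fn₂_fn, hM.fn₂_fn, hM.mem_fn_iff]
  exact hM.mem_mono (fun v hv => hv.1 _ hv.2.1 _ hv.2.2) (hM.mem_inter ht (hM.mem_inter hx hP))

theorem IsJpSet.exists_hyperfinite (hM : M.Transfer)
    (hsat : M.Saturated (Order.succ (Cardinal.mk (Set ℕ)))) (hA : IsJpSet A) :
    ∃ (η : M.Star ℕ) (β : M.Star PFin) (I : M.Star (Finset IPSet)) (H : M.Star (Finset PolyP)),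
      (∀ x : IPSet, M.MemFin (M.const x) I) ∧ (∀ P : PolyP, M.MemFin (M.const P) H) ∧
      ∀ x : M.Star IPSet, M.MemFin x I → ∀ P : M.Star PolyP, M.MemFin P H →
        M.fn₂ (fun a b : ℕ => a + b) η
          (M.fn₂ PolyP.toFun P (M.fn₂ (fun (z : IPSet) (γ : PFin) => z.1 γ) x β)) ∈ M.set A := by
  obtain ⟨t, ht⟩ := hsat.exists_mem_set hM mk_ipSet_sum_polyP_le
    (Sum.elim (fun x => goodQuadruples A ∩ {t | x ∈ t.2.2.1})
      (fun P => goodQuadruples A ∩ {t | P ∈ t.2.2.2})) fun s => by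
    obtain ⟨a, β, h⟩ := hA.exists_good s.toLeft s.toRight
    refine ⟨(a, β, s.toLeft, s.toRight), Set.mem_iInter₂.2 fun i hi => ?_⟩
    rcases i with x | P
    · exact ⟨h, Finset.mem_toLeft.2 hi⟩
    · exact ⟨h, Finset.mem_toRight.2 hi⟩
  have hgood : t ∈ M.set (goodQuadruples A) :=
    -- Any index will do; the polynomial `X` is one.
    hM.mem_mono Set.inter_subset_left (ht (Sum.inr ⟨X, by simp, fun n hn => by simpa using hn⟩))
  refine ⟨M.fn (fun t => t.1) t, M.fn (fun t => t.2.1) t, M.fn (fun t => t.2.2.1) t,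
    M.fn (fun t => t.2.2.2) t, fun x => ?_, fun P => ?_, fun x hx P hP => ?_⟩
  · rw [hM.const_eq_fn x t, hM.memFin_fn_iff]
    exact hM.mem_mono Set.inter_subset_right (ht (Sum.inl x))
  · rw [hM.const_eq_fn P t, hM.memFin_fn_iff]
    exact hM.mem_mono Set.inter_subset_right (ht (Sum.inr P))
  · exact mem_star_of_mem_goodQuadruples hM hgood hx hP

end Characterizations

theorem mainTheorem11 (M : FullStructure.{u}) (hM : M.Transfer)
    (hsat : M.Saturated (Order.succ (Cardinal.mk (Set ℕ)))) (A : Set ℕ) :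
    List.TFAE [
      IsJpSet A,
      ∃ (η : M.Star ℕ) (β : M.Star PFin), ∀ (x : IPSet) (P : PolyP),
        M.fn₂ (fun a b : ℕ => a + b) η (M.fn P.toFun (M.fn x.1 β)) ∈ M.set A,
      ∃ (η : M.Star ℕ) (β : M.Star PFin) (I : M.Star (Finset IPSet)) (H : M.Star (Finset PolyP)),
        (∀ x : IPSet, M.MemFin (M.const x) I) ∧ (∀ P : PolyP, M.MemFin (M.const P) H) ∧
        ∀ x : M.Star IPSet, M.MemFin x I → ∀ P : M.Star PolyP, M.MemFin P H →
          M.fn₂ (fun a b : ℕ => a + b) η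
            (M.fn₂ PolyP.toFun P (M.fn₂ (fun (z : IPSet) (γ : PFin) => z.1 γ) x β)) ∈ M.set A] := by
  tfae_have 1 → 3 := fun h => h.exists_hyperfinite hM hsat
  tfae_have 3 → 2 := by
    rintro ⟨η, β, I, H, hI, hH, h⟩
    refine ⟨η, β, fun x P => ?_⟩
    have hxP := h _ (hI x) _ (hH P)
    rwa [hM.fn₂_const, hM.fn₂_const] at hxP
  tfae_have 2 → 1 := fun ⟨_, _, h⟩ => IsJpSet.of_exists_star hM h
  tfae_finish
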